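/- **Definitions.** For $n\ge 1$ let $B_s(n)$ be the universal unital $C^*$-algebra generated by elements $u_{i,j}$ $(1\le i,j\le n)$ and $\mathbf P$ subject to the relations: $\mathbf P$ and all $u_{i,j}$ are orthogonal projections; $u_{i,k}u_{i,l}=0$ and $u_{k,i}u_{l,i}=0$ whenever $k\neq l$; and $\sum_{k=1}^n u_{k,i}\mathbf P=\mathbf P$ for every $i$. Let $\mathcal B_s(n)=\mathbf P B_s(n)\mathbf P$, which has unit $\mathbf P$. The linear coaction of $\mathcal B_s(n)$ is the linear map $\mathcal L_n:\mathbb C\langle X_1,\dots,X_n\rangle\to\mathbb C\langle X_1,\dots,X_n\rangle\otimes\mathcal B_s(n)$ (algebraic tensor product) given on monomials, for all $k\ge 0$, by $$\mathcal L_n(X_{i_1}\cdots X_{i_k})=\sum_{j_1,\dots,j_k=1}^n X_{j_1}\cdots X_{j_k}\otimes \mathbf P u_{j_1,i_1}\cdots u_{j_k,i_k}\mathbf P .$$ For a sequence $(x_i)_{i\in\mathbb N}$ in a unital complex algebra $\mathcal A$ with a linear functional $\phi$, $\phi(1)=1$, let $\mu_{x_1,\dots,x_n}(p)=\phi(p(x_1,\dots,x_n))$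 for $p\in\mathbb C\langle X_1,\dots,X_n\rangle$. The joint distribution of $(x_i)_{i\in\mathbb N}$ satisfies the invariance conditions associated with the linear coactions of the $\mathcal B_s(n)$ if, for all $n$ and all $p\in\mathbb C\langle X_1,\dots,X_n\rangle$, $$\mu_{x_1,\dots,x_n}(p)\,\mathbf P=(\mu_{x_1,\dots,x_n}\otimes \mathrm{id}_{\mathcal B_s(n)})(\mathcal L_n p).$$ **Theorem.** Let $\mathcal A$ be a $W^*$-algebra, let $\phi$ be a faithful normal state on $\mathcal A$, and let $(x_i)_{i\in\mathbb N}$ be a sequence of selfadjoint elements of $\mathcal A$ that generates $\mathcal A$ as a $W^*$-algebra (that is, the unital $*$-subalgebra generated by the $x_i$ is ultraweakly dense in $\mathcal A$). Then the following are equivalent: a) the joint distribution of $(x_i)_{i\in\mathbb N}$ satisfies the invariance conditions associated with the linear coactions of the $\mathcal B_s(n)$; b) $x_i=x_j$ for all $i,j\in\mathbb N$. -/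

import Mathlib

open scoped ComplexOrder TensorProduct

noncomputable section

/-! ### The universal `C*`-algebra `B_s(n)` -/

/-- The generators `u i j` (`i, j < n`) and `P` of `B_s(n)`. -/
inductive BsGen (n : ℕ) : Type
  | u (i j : Fin n) : BsGen n
  | P : BsGen n

/-- The unital `*`-algebra freely generated by self-adjoint elements `u i j` and `P`. -/
def BsFree (n : ℕ) : Type := MonoidAlgebra ℂ (FreeMonoid (BsGen n))

namespace BsFree

variable (n : ℕ)

instance : Ring (BsFree n) := inferInstanceAs (Ring (MonoidAlgebra ℂ (FreeMonoid (BsGen n))))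

instance : Algebra ℂ (BsFree n) :=
  inferInstanceAs (Algebra ℂ (MonoidAlgebra ℂ (FreeMonoid (BsGen n))))

variable {n}

/-- The scalar multiple `c • w` of a word `w` in the generators. -/
def word (w : FreeMonoid (BsGen n)) (c : ℂ) : BsFree n := MonoidAlgebra.single w c

/-- A generator, as an element of the free algebra. -/
def gen (g : BsGen n) : BsFree n := word (FreeMonoid.of g) 1

/-- The free generator `u i j`. -/
def u (i j : Fin n) : BsFree n := gen (BsGen.u i j)

/-- The free generator `P`. -/
def P : BsFree n := gen BsGen.P

theorem word_add (w : FreeMonoid (BsGen n)) (c d : ℂ) :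
    word w (c + d) = word w c + word w d := MonoidAlgebra.single_add _ _ _

theorem word_mul_word (w w' : FreeMonoid (BsGen n)) (c d : ℂ) :
    word w c * word w' d = word (w * w') (c * d) := MonoidAlgebra.single_mul_single ..

theorem one_eq_word : (1 : BsFree n) = word 1 1 := MonoidAlgebra.one_def

theorem smul_word (c d : ℂ) (w : FreeMonoid (BsGen n)) : c • word w d = word w (c * d) :=
  MonoidAlgebra.smul_single ..

theorem induction_words {motive : BsFree n → Prop} (a : BsFree n) (zero : motive 0)
    (add : ∀ a b, motive a → motive b → motive (a + b)) (word : ∀ w c, motive (word w c)) :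
    motive a :=
  MonoidAlgebra.induction_linear a zero add word

/-- The conjugate-linear map that reverses words, as an additive map. -/
def starAux : BsFree n →+ BsFree n where
  toFun a := a.coeff.sum fun w c => word (star w) (star c)
  map_zero' := Finsupp.sum_zero_index
  map_add' a b := by
    refine Finsupp.sum_add_index' (f := a.coeff) (g := b.coeff) ?_ ?_
    · intro w
      rw [star_zero]
      exact MonoidAlgebra.single_zero _
    · intro w c d
      rw [star_add, word_add]

theorem starAux_word (w : FreeMonoid (BsGen n)) (c : ℂ) :
    starAux (word w c) = word (star w) (star c) := by
  refine Finsupp.sum_single_index (a := w) (b := c)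
    (h := fun w c => (word (star w) (star c) : BsFree n)) ?_
  rw [star_zero]
  exact MonoidAlgebra.single_zero _

/-- The involution: `(∑ c_w w)* = ∑ conj(c_w) w^rev`; every generator is self-adjoint. -/
instance : StarRing (BsFree n) where
  star := starAux
  star_involutive a := by
    induction a using induction_words with
    | zero => simp
    | add a b ha hb => rw [map_add, map_add, ha, hb]
    | word w c => rw [starAux_word, starAux_word, star_star, star_star]
  star_mul a b := by
    induction a using induction_words with
    | zero => simp
    | add a a' ha ha' => rw [add_mul, map_add, map_add, mul_add, ha, ha']
    | word w c =>
      induction b using induction_words with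
      | zero => simp
      | add b b' hb hb' => rw [mul_add, map_add, map_add, add_mul, hb, hb']
      | word w' c' =>
        rw [starAux_word, starAux_word, word_mul_word, word_mul_word, starAux_word, star_mul,
          star_mul]
  star_add a b := map_add _ a b

theorem star_word (w : FreeMonoid (BsGen n)) (c : ℂ) :
    star (word w c) = word (star w) (star c) := starAux_word w c

theorem star_gen (g : BsGen n) : star (gen g) = gen g := by
  rw [gen, star_word, FreeMonoid.star_of, star_one]

instance : StarModule ℂ (BsFree n) where
  star_smul c a := by
    induction a using induction_words with
    | zero => simp
    | add a b ha hb => rw [smul_add, star_add, star_add, smul_add, ha, hb]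
    | word w d => rw [smul_word, star_word, star_word, smul_word, star_mul, mul_comm]

end BsFree

open BsFree in
/-- The elements that are set to zero in `B_s(n)`; together with self-adjointness of the
generators they say that `P` and all `u i j` are projections, that distinct entries of a row or of
a column of `u` are orthogonal, and that `∑ k, u k i * P = P` for all `i`. -/
inductive BsRelator (n : ℕ) : BsFree n → Prop
  | idem_u (i j : Fin n) : BsRelator n (u i j * u i j - u i j)
  | idem_P : BsRelator n (P * P - P)
  | row (i k l : Fin n) (h : k ≠ l) : BsRelator n (u i k * u i l)
  | col (i k l : Fin n) (h : k ≠ l) : BsRelator n (u k i * u l i)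
  | sum (i : Fin n) : BsRelator n ((∑ k, u k i * P) - P)

/-- The `C*`-seminorms on the free `*`-algebra that vanish on the relators. -/
structure BsSeminorm (n : ℕ) extends RingSeminorm (BsFree n) where
  smul' : ∀ (c : ℂ) (a : BsFree n), toFun (c • a) = ‖c‖ * toFun a
  cstar' : ∀ a : BsFree n, toFun (star a * a) = toFun a * toFun a
  relator' : ∀ r, BsRelator n r → toFun r = 0

namespace BsSeminorm

open BsFree

variable {n : ℕ}

instance : CoeFun (BsSeminorm n) fun _ => BsFree n → ℝ := ⟨fun p => p.toFun⟩

variable (p : BsSeminorm n)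

theorem nonneg (a : BsFree n) : 0 ≤ p a := apply_nonneg p.toRingSeminorm a

theorem add_le (a b : BsFree n) : p (a + b) ≤ p a + p b := map_add_le_add p.toRingSeminorm a b

theorem mul_le (a b : BsFree n) : p (a * b) ≤ p a * p b := p.mul_le' a b

theorem le_one_of_idem (a : BsFree n) (hs : star a = a) (h : p (a * a - a) = 0) : p a ≤ 1 := by
  have h1 : p a * p a = p (a * a) := by rw [← p.cstar', hs]
  have h2 : p (a * a) ≤ p (a * a - a) + p a := by
    simpa using p.add_le (a * a - a) a
  nlinarith [p.nonneg a]

theorem gen_le_one (g : BsGen n) : p (gen g) ≤ 1 := by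
  refine p.le_one_of_idem _ (star_gen g) ?_
  cases g with
  | u i j => exact p.relator' _ (.idem_u i j)
  | P => exact p.relator' _ .idem_P

theorem word_le (w : FreeMonoid (BsGen n)) : p (word w 1) ≤ 1 := by
  induction w using FreeMonoid.recOn with
  | one =>
    refine p.le_one_of_idem _ ?_ ?_
    · rw [star_word, star_one, star_one]
    · rw [← one_eq_word, mul_one, sub_self]
      exact map_zero p.toRingSeminorm
  | of_mul g w hw =>
    have h := p.mul_le (gen g) (word w 1)
    rw [gen, word_mul_word, one_mul] at h
    calc _ ≤ _ := h
      _ ≤ 1 * 1 := mul_le_mul (p.gen_le_one g) hw (p.nonneg _) zero_le_one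
      _ = 1 := one_mul 1

theorem bounded (a : BsFree n) : ∃ C, ∀ p : BsSeminorm n, p a ≤ C := by
  induction a using induction_words with
  | zero => exact ⟨0, fun p => (map_zero p.toRingSeminorm).le⟩
  | add a b ha hb =>
    obtain ⟨C, hC⟩ := ha
    obtain ⟨D, hD⟩ := hb
    exact ⟨C + D, fun p => (p.add_le a b).trans (add_le_add (hC p) (hD p))⟩
  | word w c =>
    refine ⟨‖c‖, fun p => ?_⟩
    have h : word w c = c • word w 1 := by rw [smul_word, mul_one]
    rw [h, p.smul']
    exact mul_le_of_le_one_right (norm_nonneg c) (p.word_le w)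

theorem bddAbove (a : BsFree n) : BddAbove (Set.range fun p : BsSeminorm n => p a) := by
  obtain ⟨C, hC⟩ := bounded a
  exact ⟨C, by rintro _ ⟨p, rfl⟩; exact hC p⟩

instance : Nonempty (BsSeminorm n) :=
  ⟨{ toRingSeminorm := 0
     smul' := fun c _ => (mul_zero ‖c‖).symm
     cstar' := fun _ => (mul_zero (0 : ℝ)).symm
     relator' := fun _ _ => rfl }⟩

variable (n) in
/-- The largest `C*`-seminorm on the free `*`-algebra that vanishes on the relators. -/
def universal : BsSeminorm n where
  toFun a := ⨆ p : BsSeminorm n, p a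
  map_zero' := by
    have h : ∀ p : BsSeminorm n, p 0 = 0 := fun p => map_zero p.toRingSeminorm
    simp [h]
  add_le' a b := ciSup_le fun p => (p.add_le a b).trans
    (add_le_add (le_ciSup (bddAbove a) p) (le_ciSup (bddAbove b) p))
  neg' a := by
    have h : ∀ p : BsSeminorm n, p (-a) = p a := fun p => map_neg_eq_map p.toRingSeminorm a
    simp [h]
  mul_le' a b := ciSup_le fun p => (p.mul_le a b).trans
    (mul_le_mul (le_ciSup (bddAbove a) p) (le_ciSup (bddAbove b) p) (p.nonneg b)
      (Real.iSup_nonneg fun q => q.nonneg a))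
  smul' c a := by
    simp only [BsSeminorm.smul']
    exact (Real.mul_iSup_of_nonneg (norm_nonneg c) _).symm
  cstar' a := by
    simp only [BsSeminorm.cstar']
    have h0 : 0 ≤ ⨆ p : BsSeminorm n, p a := Real.iSup_nonneg fun q => q.nonneg a
    refine le_antisymm (ciSup_le fun p => mul_self_le_mul_self (p.nonneg a)
      (le_ciSup (bddAbove a) p)) ?_
    have hb : BddAbove (Set.range fun p : BsSeminorm n => p a * p a) := by
      simpa only [BsSeminorm.cstar'] using bddAbove (star a * a)
    have hs : 0 ≤ ⨆ p : BsSeminorm n, p a * p a :=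
      Real.iSup_nonneg fun q => mul_self_nonneg _
    rw [← sq, ← Real.le_sqrt h0 hs]
    refine ciSup_le fun p => Real.le_sqrt_of_sq_le ?_
    rw [sq]
    exact le_ciSup hb p
  relator' r hr := by
    have h : ∀ p : BsSeminorm n, p r = 0 := fun p => p.relator' r hr
    simp [h]

end BsSeminorm

instance (n : ℕ) : SeminormedRing (BsFree n) :=
  (BsSeminorm.universal n).toRingSeminorm.toSeminormedRing

instance (n : ℕ) : NormedAlgebra ℂ (BsFree n) where
  norm_smul_le c a := ((BsSeminorm.universal n).smul' c a).le

theorem BsFree.norm_def {n : ℕ} (a : BsFree n) : ‖a‖ = ⨆ p : BsSeminorm n, p a := rfl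

theorem BsFree.norm_star_mul_self {n : ℕ} (a : BsFree n) : ‖star a * a‖ = ‖a‖ * ‖a‖ :=
  (BsSeminorm.universal n).cstar' a

theorem BsFree.norm_relator {n : ℕ} {r : BsFree n} (hr : BsRelator n r) : ‖r‖ = 0 :=
  (BsSeminorm.universal n).relator' r hr

theorem BsFree.norm_star_le {n : ℕ} (a : BsFree n) : ‖star a‖ ≤ ‖a‖ := by
  have key : ∀ b : BsFree n, ‖b‖ ≤ ‖star b‖ := fun b => by
    have h : ‖b‖ * ‖b‖ ≤ ‖star b‖ * ‖b‖ := by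
      rw [← BsFree.norm_star_mul_self]
      exact norm_mul_le _ _
    rcases (norm_nonneg b).eq_or_lt with h0 | h0
    · rw [← h0]; exact norm_nonneg _
    · exact le_of_mul_le_mul_right h h0
  simpa using key (star a)

/-- The universal unital `C*`-algebra `B_s(n)` generated by projections `u i j` (`i, j < n`) and
`P` such that distinct entries of a row or of a column of `u` are orthogonal and
`∑ k, u k i * P = P` for all `i`: the separated completion of the free `*`-algebra on these
generators in the largest `C*`-seminorm that respects the relations. -/
def Bs (n : ℕ) : Type := UniformSpace.Completion (BsFree n)

namespace Bs

variable {n : ℕ}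

instance : NormedRing (Bs n) := inferInstanceAs (NormedRing (UniformSpace.Completion (BsFree n)))

instance : CompleteSpace (Bs n) :=
  inferInstanceAs (CompleteSpace (UniformSpace.Completion (BsFree n)))

instance : Algebra ℂ (Bs n) := inferInstanceAs (Algebra ℂ (UniformSpace.Completion (BsFree n)))

instance : NormedAlgebra ℂ (Bs n) where
  norm_smul_le := norm_smul_le (α := ℂ) (β := UniformSpace.Completion (BsFree n))

variable (n) in
/-- The canonical homomorphism from the free `*`-algebra to `B_s(n)`. -/
def of : BsFree n →ₐ[ℂ] Bs n where
  __ := (UniformSpace.Completion.coeRingHom : BsFree n →+* UniformSpace.Completion (BsFree n))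
  commutes' _ := rfl

theorem norm_of (a : BsFree n) : ‖of n a‖ = ‖a‖ := UniformSpace.Completion.norm_coe a

theorem denseRange_of : DenseRange (of n) := UniformSpace.Completion.denseRange_coe

theorem continuous_of : Continuous (of n) := UniformSpace.Completion.continuous_coe _

theorem uniformContinuous_star : UniformContinuous (star : BsFree n → BsFree n) :=
  AddMonoidHomClass.uniformContinuous_of_bound (starAddEquiv : BsFree n ≃+ BsFree n) 1
    fun a => by simpa using BsFree.norm_star_le a

/-- The involution of `B_s(n)`, extended from the free `*`-algebra by continuity. -/
instance : Star (Bs n) := ⟨UniformSpace.Completion.map (star : BsFree n → BsFree n)⟩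

theorem star_of (a : BsFree n) : star (of n a) = of n (star a) :=
  UniformSpace.Completion.map_coe uniformContinuous_star a

theorem continuous_star : Continuous (star : Bs n → Bs n) := UniformSpace.Completion.continuous_map

instance : StarRing (Bs n) where
  star_involutive a := by
    refine denseRange_of.induction_on (p := fun a => star (star a) = a) a
      (isClosed_eq (continuous_star.comp continuous_star) continuous_id) fun a => ?_
    rw [star_of, star_of, star_star]
  star_mul a b := by
    refine denseRange_of.induction_on₂ (p := fun a b => star (a * b) = star b * star a)
      (isClosed_eq (continuous_star.comp continuous_mul)
        ((continuous_star.comp continuous_snd).mul (continuous_star.comp continuous_fst)))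
      (fun a b => ?_) a b
    rw [← map_mul, star_of, star_of, star_of, star_mul, map_mul]
  star_add a b := by
    refine denseRange_of.induction_on₂ (p := fun a b => star (a + b) = star a + star b)
      (isClosed_eq (continuous_star.comp continuous_add)
        ((continuous_star.comp continuous_fst).add (continuous_star.comp continuous_snd)))
      (fun a b => ?_) a b
    rw [← map_add, star_of, star_of, star_of, star_add, map_add]

instance : CStarAlgebra (Bs n) where
  norm_mul_self_le a := by
    refine denseRange_of.induction_on (p := fun a => ‖a‖ * ‖a‖ ≤ ‖star a * a‖) a
      (isClosed_le (continuous_norm.mul continuous_norm)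
        (continuous_norm.comp (continuous_star.mul continuous_id))) fun a => ?_
    rw [star_of, ← map_mul, norm_of, norm_of, BsFree.norm_star_mul_self]
  star_smul c a := by
    refine denseRange_of.induction_on (p := fun a => star (c • a) = star c • star a) a
      (isClosed_eq (continuous_star.comp (continuous_const_smul c))
        ((continuous_const_smul (star c)).comp continuous_star)) fun a => ?_
    rw [← map_smul, star_of, star_of, star_smul, map_smul]

/-- The standard generators `u i j` of `B_s(n)`. -/
def u (i j : Fin n) : Bs n := of n (BsFree.u i j)

variable (n) in
/-- The invariant projection `P` of `B_s(n)`. -/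
def P : Bs n := of n BsFree.P

theorem of_relator {r : BsFree n} (hr : BsRelator n r) : of n r = 0 := by
  rw [← norm_eq_zero, norm_of, BsFree.norm_relator hr]

theorem star_u (i j : Fin n) : star (u i j) = u i j := by
  rw [u, star_of, BsFree.u, BsFree.star_gen]

theorem star_P : star (P n) = P n := by
  rw [P, star_of, BsFree.P, BsFree.star_gen]

theorem u_mul_self (i j : Fin n) : u i j * u i j = u i j := by
  have h := of_relator (BsRelator.idem_u i j)
  rwa [map_sub, map_mul, sub_eq_zero] at h

theorem P_mul_self : P n * P n = P n := by
  have h := of_relator (BsRelator.idem_P (n := n))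
  rwa [map_sub, map_mul, sub_eq_zero] at h

theorem u_mul_u_row (i : Fin n) {k l : Fin n} (hkl : k ≠ l) : u i k * u i l = 0 := by
  have h := of_relator (BsRelator.row i k l hkl)
  rwa [map_mul] at h

theorem u_mul_u_col (i : Fin n) {k l : Fin n} (hkl : k ≠ l) : u k i * u l i = 0 := by
  have h := of_relator (BsRelator.col i k l hkl)
  rwa [map_mul] at h

theorem sum_u_mul_P (i : Fin n) : ∑ k, u k i * P n = P n := by
  have h := of_relator (BsRelator.sum i)
  rw [map_sub, map_sum, sub_eq_zero] at h
  simp only [map_mul] at h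
  exact h

/-- The universal property of `B_s(n)`. -/
theorem existsUnique_lift {D : Type*} [CStarAlgebra D] (v : Fin n → Fin n → D) (Q : D)
    (hv : ∀ i j, star (v i j) = v i j ∧ v i j * v i j = v i j) (hQ : star Q = Q ∧ Q * Q = Q)
    (hrow : ∀ i k l, k ≠ l → v i k * v i l = 0) (hcol : ∀ i k l, k ≠ l → v k i * v l i = 0)
    (hsum : ∀ i, ∑ k, v k i * Q = Q) :
    ∃! f : Bs n →⋆ₐ[ℂ] D, (∀ i j, f (u i j) = v i j) ∧ f (P n) = Q := by
  let g : BsGen n → D := fun x => match x with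
    | .u i j => v i j
    | .P => Q
  have hg : ∀ x, star (g x) = g x := by
    rintro (⟨i, j⟩ | _)
    · exact (hv i j).1
    · exact hQ.1
  let F : BsFree n →ₐ[ℂ] D := MonoidAlgebra.lift ℂ D (FreeMonoid (BsGen n)) (FreeMonoid.lift g)
  have hFw : ∀ w c, F (BsFree.word w c) = c • FreeMonoid.lift g w :=
    fun w c => MonoidAlgebra.lift_single _ _ _
  have hFg : ∀ x, F (BsFree.gen x) = g x := fun x => by
    rw [BsFree.gen, hFw, one_smul, FreeMonoid.lift_eval_of]
  have hFu : ∀ i j, F (BsFree.u i j) = v i j := fun i j => hFg _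
  have hFP : F BsFree.P = Q := hFg _
  have hws : ∀ w, FreeMonoid.lift g (star w) = star (FreeMonoid.lift g w) := by
    intro w
    induction w using FreeMonoid.recOn with
    | one => simp
    | of_mul x w hw => simp [hw, hg]
  have hFs : ∀ a, F (star a) = star (F a) := by
    intro a
    induction a using BsFree.induction_words with
    | zero => simp
    | add a b ha hb => rw [star_add, map_add, ha, hb, map_add, star_add]
    | word w c => rw [BsFree.star_word, hFw, hFw, hws, star_smul]
  have hFr : ∀ r, BsRelator n r → F r = 0 := by
    rintro r (⟨i, j⟩ | _ | ⟨i, k, l, h⟩ | ⟨i, k, l, h⟩ | ⟨i⟩)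
    · rw [map_sub, map_mul, hFu, (hv i j).2, sub_self]
    · rw [map_sub, map_mul, hFP, hQ.2, sub_self]
    · rw [map_mul, hFu, hFu, hrow i k l h]
    · rw [map_mul, hFu, hFu, hcol i k l h]
    · simp only [map_sub, map_sum, map_mul, hFu, hFP, hsum, sub_self]
  let p : BsSeminorm n :=
    { toFun := fun a => ‖F a‖
      map_zero' := by simp
      add_le' := fun a b => by rw [map_add]; exact norm_add_le _ _
      neg' := fun a => by rw [map_neg, norm_neg]
      mul_le' := fun a b => by rw [map_mul]; exact norm_mul_le _ _
      smul' := fun c a => by rw [map_smul, norm_smul]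
      cstar' := fun a => by rw [map_mul, hFs, CStarRing.norm_star_mul_self]
      relator' := fun r hr => by rw [hFr r hr, norm_zero] }
  have hle : ∀ a, ‖F a‖ ≤ ‖a‖ := fun a => le_ciSup (BsSeminorm.bddAbove a) p
  have hFc : Continuous F :=
    AddMonoidHomClass.continuous_of_bound F 1 fun a => by simpa using hle a
  let E : Bs n →+* D := UniformSpace.Completion.extensionHom F.toRingHom hFc
  have hE : ∀ a, E (of n a) = F a := fun a =>
    UniformSpace.Completion.extensionHom_coe F.toRingHom hFc a
  have hEc : Continuous E := UniformSpace.Completion.continuous_extension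
  let f : Bs n →⋆ₐ[ℂ] D :=
    { E with
      commutes' := fun c => by
        have h : algebraMap ℂ (Bs n) c = of n (algebraMap ℂ (BsFree n) c) := rfl
        change E _ = _
        rw [h, hE, AlgHom.commutes]
      map_star' := fun a => by
        change E _ = star (E _)
        refine denseRange_of.induction_on (p := fun a => E (star a) = star (E a)) a
          (isClosed_eq (hEc.comp continuous_star) (ContinuousStar.continuous_star.comp hEc)) fun a => ?_
        rw [star_of, hE, hE, hFs] }
  refine ⟨f, ⟨fun i j => (hE _).trans (hFu i j), (hE _).trans hFP⟩, ?_⟩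
  rintro f' ⟨hu, hP⟩
  have hf'c : Continuous f' := AddMonoidHomClass.continuous_of_bound f' 1
    fun a => by simpa using NonUnitalStarAlgHom.norm_apply_le f' a
  have hgen : ∀ x, f' (of n (BsFree.gen x)) = g x := by
    rintro (⟨i, j⟩ | _)
    · exact hu i j
    · exact hP
  have hword : ∀ w, f' (of n (BsFree.word w 1)) = FreeMonoid.lift g w := by
    intro w
    induction w using FreeMonoid.recOn with
    | one => rw [← BsFree.one_eq_word, map_one, map_one, map_one]
    | of_mul x w hw =>
      have h : BsFree.word (FreeMonoid.of x * w) 1 = BsFree.gen x * BsFree.word w 1 := by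
        rw [BsFree.gen, BsFree.word_mul_word, one_mul]
      rw [h, map_mul, map_mul, hgen, hw, map_mul, FreeMonoid.lift_eval_of]
  have hfree : ∀ a, f' (of n a) = F a := by
    intro a
    induction a using BsFree.induction_words with
    | zero => simp
    | add a b ha hb => rw [map_add, map_add, ha, hb, map_add]
    | word w c =>
      have h : BsFree.word w c = c • BsFree.word w 1 := by rw [BsFree.smul_word, mul_one]
      rw [h, map_smul, map_smul, hword, map_smul, hFw, one_smul]
  ext a
  refine denseRange_of.induction_on (p := fun a => f' a = f a) a
    (isClosed_eq hf'c hEc) fun a => ?_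
  exact (hfree a).trans (hE a).symm

end Bs

/-- The boolean permutation quantum semigroup `P B_s(n) P`: the corner of `B_s(n)` at the
projection `P`, with unit `P`. -/
def BoolPerm (n : ℕ) : NonUnitalStarSubalgebra ℂ (Bs n) where
  carrier := {b | ∃ a : Bs n, b = Bs.P n * a * Bs.P n}
  add_mem' := by
    rintro _ _ ⟨a, rfl⟩ ⟨b, rfl⟩
    exact ⟨a + b, by rw [mul_add, add_mul]⟩
  zero_mem' := ⟨0, by rw [mul_zero, zero_mul]⟩
  mul_mem' := by
    rintro _ _ ⟨a, rfl⟩ ⟨b, rfl⟩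
    exact ⟨a * Bs.P n * Bs.P n * b, by simp only [mul_assoc]⟩
  smul_mem' := by
    rintro c _ ⟨a, rfl⟩
    exact ⟨c • a, by rw [mul_smul_comm, smul_mul_assoc]⟩
  star_mem' := by
    rintro _ ⟨a, rfl⟩
    exact ⟨star a, by simp only [star_mul, Bs.star_P, mul_assoc]⟩

namespace BoolPerm

variable {n : ℕ}

/-- The compression `a ↦ P a P` of an element of `B_s(n)`. -/
def compress (a : Bs n) : BoolPerm n := ⟨Bs.P n * a * Bs.P n, a, rfl⟩

variable (n) in
/-- The unit `P` of the boolean permutation quantum semigroup. -/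
def unit : BoolPerm n := ⟨Bs.P n, 1, by rw [mul_one, Bs.P_mul_self]⟩

variable (n) in
/-- The linear coaction on noncommutative polynomials, given on the basis of monomials by
`X_{i_1} ⋯ X_{i_k} ↦ ∑_{j_1, …, j_k} X_{j_1} ⋯ X_{j_k} ⊗ P u_{j_1 i_1} ⋯ u_{j_k i_k} P`. -/
def linearCoaction : FreeAlgebra ℂ (Fin n) →ₗ[ℂ] FreeAlgebra ℂ (Fin n) ⊗[ℂ] BoolPerm n :=
  (FreeAlgebra.basisFreeMonoid ℂ (Fin n)).constr ℂ fun w =>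
    ∑ j : Fin w.toList.length → Fin n,
      (List.ofFn fun t => FreeAlgebra.ι ℂ (j t)).prod ⊗ₜ[ℂ]
        compress (List.ofFn fun t => Bs.u (j t) (w.toList.get t)).prod

end BoolPerm

/-! ### Joint distributions and invariance -/

/-- The joint distribution of the family `x` with respect to the linear functional `φ`, a linear
functional on the noncommutative polynomials. -/
def jointDistribution {A ι : Type*} [Ring A] [Algebra ℂ A] (φ : A →ₗ[ℂ] ℂ) (x : ι → A) :
    FreeAlgebra ℂ ι →ₗ[ℂ] ℂ :=
  φ ∘ₗ (FreeAlgebra.lift ℂ x).toLinearMap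

/-- Invariance of a linear functional `μ` on the noncommutative polynomials in `n` indeterminates
under the linear coaction: `(μ ⊗ id)(L_n p) = μ(p) P` for all `p`. -/
def IsLinearCoactionInvariant (n : ℕ) (μ : FreeAlgebra ℂ (Fin n) →ₗ[ℂ] ℂ) : Prop :=
  ∀ p : FreeAlgebra ℂ (Fin n),
    TensorProduct.lid ℂ (BoolPerm n) (μ.rTensor (BoolPerm n) (BoolPerm.linearCoaction n p)) =
      μ p • BoolPerm.unit n

/-- The joint distribution of the infinite sequence `x` satisfies the invariance conditions
associated with the linear coactions, for all `n`. -/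
def SatisfiesLinearInvariance {A : Type*} [Ring A] [Algebra ℂ A] (φ : A →ₗ[ℂ] ℂ) (x : ℕ → A) :
    Prop :=
  ∀ n : ℕ, IsLinearCoactionInvariant n (jointDistribution φ fun i : Fin n => x i)

/-! ### `W*`-probability spaces -/

section WStar

variable {A : Type*} [CStarAlgebra A] [PartialOrder A]

/-- A positive functional is normal if it preserves suprema of bounded increasing nets. -/
def IsNormalFunctional (φ : A →ₚ[ℂ] ℂ) : Prop :=
  ∀ s : Set A, s.Nonempty → DirectedOn (· ≤ ·) s → ∀ a, IsLUB s a → IsLUB (φ '' s) (φ a)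

/-- A state: a positive functional with `φ 1 = 1`. -/
def IsState (φ : A →ₚ[ℂ] ℂ) : Prop := φ 1 = 1

/-- A positive functional is faithful if `φ (a* a) = 0` only for `a = 0`. -/
def IsFaithfulFunctional (φ : A →ₚ[ℂ] ℂ) : Prop := ∀ a, φ (star a * a) = 0 → a = 0

variable (A) in
/-- The ultraweak topology of a `W*`-algebra: the weak topology induced by the normal positive
functionals (whose span is the predual). -/
@[reducible] def ultraweakTopology : TopologicalSpace A :=
  ⨅ (ψ : A →ₚ[ℂ] ℂ) (_ : IsNormalFunctional ψ), TopologicalSpace.induced ψ inferInstance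

/-- The `W*`-algebra `A` is generated by the family `x`: the unital `*`-subalgebra generated by `x`
is ultraweakly dense. -/
def IsWStarGeneratedBy {ι : Type*} (x : ι → A) : Prop :=
  @closure A (ultraweakTopology A) (StarAlgebra.adjoin ℂ (Set.range x) : Set A) = Set.univ

end WStar

end

/-! A constant sequence is invariant because its moments factor out of the coaction, leaving `P`
times a product of column sums of `u` times `P`; each column sum fixes `P`
(`isLinearCoactionInvariant_const`).

Conversely, by universality invariance may be tested in any model of the relations. A model in 2×2
matrices uses projections `Q`, `p` with `Q * p * Q = Q / 2`, where `p` and `1 - p` mix two indices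
`a`, `b`. It shows that all `x i` have the same moments (`pow_eq`) and, for `c` distinct from `a`
and `b`, that `φ ((x a - x b) * x c ^ 2 * (x a - x b)) = 0` (`map_sub_mul_sub_eq_zero`).
Faithfulness gives `x c * x a = x c * x b`, so the product of two distinct members is always the
same element `T` (`mul_eq`).

Then the elements `x i ^ 2 - T` are pairwise orthogonal with common first and second moments.
Infinitely many such elements must be centered (`map_eq_zero_of_orthogonal`), so `φ (x i ^ 2) = φ
T`. Hence `φ ((x i - x j) ^ 2) = 0` for `i ≠ j`, and faithfulness concludes. -/

/-! ### Invariance on words, and constant sequences. -/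

/-- Exhibits the multi-index sum in the coaction as an expanded product of column sums, one for each
letter; both directions of the theorem rely on this. -/
theorem List.prod_map_sum_eq_sum_prod_ofFn {R κ ι : Type*} [Semiring R] [Fintype κ]
    (g : κ → ι → R) (l : List ι) :
    (l.map fun i => ∑ j, g j i).prod =
      ∑ j : Fin l.length → κ, (List.ofFn fun t => g (j t) (l.get t)).prod := by
  induction l with
  | nil => simp
  | cons i l ih =>
    rw [List.map_cons, List.prod_cons, ih, Finset.sum_mul_sum, ← Fintype.sum_prod_type']
    refine Fintype.sum_equiv (Fin.consEquiv fun _ : Fin (l.length + 1) => κ) _ _ fun y => ?_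
    simp [List.ofFn_succ, Fin.consEquiv]

theorem List.prod_ofFn_tmul {A D : Type*} [Ring A] [Algebra ℂ A] [Ring D] [Algebra ℂ D] {k : ℕ}
    (a : Fin k → A) (d : Fin k → D) :
    (List.ofFn fun t => a t ⊗ₜ[ℂ] d t).prod = (List.ofFn a).prod ⊗ₜ[ℂ] (List.ofFn d).prod := by
  induction k with
  | zero => simp [Algebra.TensorProduct.one_def]
  | succ k ih => simp [List.ofFn_succ, ih]

theorem jointDistribution_prod_ofFn {A ι : Type*} [Ring A] [Algebra ℂ A] (φ : A →ₗ[ℂ] ℂ)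
    (x : ι → A) {k : ℕ} (j : Fin k → ι) :
    jointDistribution φ x (List.ofFn fun t => FreeAlgebra.ι ℂ (j t)).prod =
      φ (List.ofFn fun t => x (j t)).prod := by
  simp [jointDistribution, map_list_prod, List.map_ofFn, Function.comp_def]

theorem basisFreeMonoid_eq_prod {n : ℕ} (w : FreeMonoid (Fin n)) :
    FreeAlgebra.basisFreeMonoid ℂ (Fin n) w = (w.toList.map (FreeAlgebra.ι ℂ)).prod := by
  have h : FreeAlgebra.basisFreeMonoid ℂ (Fin n) w =
      FreeAlgebra.equivMonoidAlgebraFreeMonoid.symm (MonoidAlgebra.single w 1) := by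
    simp [FreeAlgebra.basisFreeMonoid]
  rw [h]
  refine (MonoidAlgebra.lift_single _ _ _).trans ?_
  rw [one_smul, FreeMonoid.lift_apply]

theorem jointDistribution_basisFreeMonoid {A : Type*} {n : ℕ} [Ring A] [Algebra ℂ A]
    (φ : A →ₗ[ℂ] ℂ) (x : Fin n → A) (w : FreeMonoid (Fin n)) :
    jointDistribution φ x (FreeAlgebra.basisFreeMonoid ℂ (Fin n) w) =
      φ (w.toList.map x).prod := by
  simp [basisFreeMonoid_eq_prod, jointDistribution, map_list_prod, Function.comp_def]

theorem lid_rTensor_linearCoaction_basis {A : Type*} {n : ℕ} [Ring A] [Algebra ℂ A]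
    (φ : A →ₗ[ℂ] ℂ) (x : Fin n → A) (w : FreeMonoid (Fin n)) :
    ((TensorProduct.lid ℂ (BoolPerm n) ((jointDistribution φ x).rTensor (BoolPerm n)
      (BoolPerm.linearCoaction n (FreeAlgebra.basisFreeMonoid ℂ (Fin n) w))) : BoolPerm n) : Bs n) =
      ∑ j : Fin w.toList.length → Fin n, φ (List.ofFn fun t => x (j t)).prod •
        (Bs.P n * (List.ofFn fun t => Bs.u (j t) (w.toList.get t)).prod * Bs.P n) := by
  rw [BoolPerm.linearCoaction, Module.Basis.constr_basis]
  simp only [map_sum, LinearMap.rTensor_tmul, TensorProduct.lid_tmul, jointDistribution_prod_ofFn,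
    BoolPerm.compress]
  rw [AddSubmonoidClass.coe_finsetSum]
  rfl

/-- Both sides of the invariance condition are linear in the polynomial, so monomials suffice; the
identity in the corner is then read in `Bs n`. -/
theorem isLinearCoactionInvariant_iff {A : Type*} {n : ℕ} [Ring A] [Algebra ℂ A]
    (φ : A →ₗ[ℂ] ℂ) (x : Fin n → A) :
    IsLinearCoactionInvariant n (jointDistribution φ x) ↔ ∀ l : List (Fin n),
      ∑ j : Fin l.length → Fin n, φ (List.ofFn fun t => x (j t)).prod •
        (Bs.P n * (List.ofFn fun t => Bs.u (j t) (l.get t)).prod * Bs.P n) =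
      φ (l.map x).prod • Bs.P n := by
  constructor
  · intro h l
    have h1 := congrArg (Subtype.val) (h (FreeAlgebra.basisFreeMonoid ℂ (Fin n) (.ofList l)))
    rw [lid_rTensor_linearCoaction_basis, jointDistribution_basisFreeMonoid] at h1
    exact h1
  · intro h p
    suffices H : (TensorProduct.lid ℂ (BoolPerm n)).toLinearMap ∘ₗ
        (jointDistribution φ x).rTensor (BoolPerm n) ∘ₗ BoolPerm.linearCoaction n =
        (jointDistribution φ x).smulRight (BoolPerm.unit n) from LinearMap.congr_fun H p
    refine (FreeAlgebra.basisFreeMonoid ℂ (Fin n)).ext fun w => Subtype.ext ?_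
    refine (lid_rTensor_linearCoaction_basis φ x w).trans ?_
    rw [LinearMap.smulRight_apply, jointDistribution_basisFreeMonoid]
    exact h w.toList

/-- The last column sum is absorbed by `P`, then the one before it, and so on to the left. -/
theorem Bs.prod_sum_u_mul_P {n : ℕ} (l : List (Fin n)) :
    (l.map fun i => ∑ j, Bs.u j i).prod * Bs.P n = Bs.P n := by
  induction l with
  | nil => simp
  | cons i l ih =>
    rw [List.map_cons, List.prod_cons, mul_assoc, ih, Finset.sum_mul, Bs.sum_u_mul_P]

theorem isLinearCoactionInvariant_const {A : Type*} {n : ℕ} [Ring A] [Algebra ℂ A]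
    (φ : A →ₗ[ℂ] ℂ) (a : A) :
    IsLinearCoactionInvariant n (jointDistribution φ fun _ => a) := by
  rw [isLinearCoactionInvariant_iff]
  intro l
  simp only [List.ofFn_const, List.prod_replicate, List.map_const']
  rw [← Finset.smul_sum, ← Finset.sum_mul, ← Finset.mul_sum,
    ← List.prod_map_sum_eq_sum_prod_ofFn (fun j i => Bs.u j i), mul_assoc, Bs.prod_sum_u_mul_P,
    Bs.P_mul_self]

/-! ### Testing invariance in concrete models of the relations. -/

/-- Slicing by `φ` after compressing by `Q` in the second leg. -/
noncomputable def sliceCompress {A D : Type*} [Ring A] [Algebra ℂ A] [Ring D] [Algebra ℂ D] (φ : A →ₗ[ℂ] ℂ)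
    (Q : D) : A ⊗[ℂ] D →ₗ[ℂ] D :=
  LinearMap.mulRight ℂ Q ∘ₗ LinearMap.mulLeft ℂ Q ∘ₗ
    (TensorProduct.lid ℂ D).toLinearMap ∘ₗ φ.rTensor D

theorem sliceCompress_tmul {A D : Type*} [Ring A] [Algebra ℂ A] [Ring D] [Algebra ℂ D]
    (φ : A →ₗ[ℂ] ℂ) (Q : D) (a : A) (d : D) :
    sliceCompress φ Q (a ⊗ₜ d) = φ a • (Q * d * Q) := by
  simp [sliceCompress]

/-- The universal property carries the word identities to any model `(v, Q)`. The compression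
happens only once, at the outside, so each letter contributes its whole column sum before the slice
is taken. -/
theorem IsLinearCoactionInvariant.sliceCompress_prod {A D : Type*} {n : ℕ} [Ring A] [Algebra ℂ A]
    [CStarAlgebra D] {φ : A →ₗ[ℂ] ℂ} {x : Fin n → A}
    (h : IsLinearCoactionInvariant n (jointDistribution φ x)) (v : Fin n → Fin n → D) (Q : D)
    (hv : ∀ i j, star (v i j) = v i j ∧ v i j * v i j = v i j) (hQ : star Q = Q ∧ Q * Q = Q)
    (hrow : ∀ i k l, k ≠ l → v i k * v i l = 0) (hcol : ∀ i k l, k ≠ l → v k i * v l i = 0)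
    (hsum : ∀ i, ∑ k, v k i * Q = Q) (l : List (Fin n)) :
    sliceCompress φ Q (l.map fun i => ∑ j, x j ⊗ₜ[ℂ] v j i).prod = φ (l.map x).prod • Q := by
  obtain ⟨f, ⟨hu, hP⟩, -⟩ := Bs.existsUnique_lift v Q hv hQ hrow hcol hsum
  have h1 := congrArg f ((isLinearCoactionInvariant_iff φ x).1 h l)
  rw [List.prod_map_sum_eq_sum_prod_ofFn (fun j i => x j ⊗ₜ[ℂ] v j i)]
  simp only [map_sum, map_smul, map_mul, hP, map_list_prod, List.map_ofFn, Function.comp_def,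
    hu] at h1
  simpa only [List.prod_ofFn_tmul, map_sum, sliceCompress_tmul] using h1

/-- Two lines in the plane at angle 45°: the compression factor is cos² 45° = 1/2. Such `Q` and `p`
cannot commute, since `Q * p * Q` would then be a projection. -/
theorem exists_projections_compress_eq_half :
    ∃ Q p : CStarMatrix (Fin 2) (Fin 2) ℂ, Q ≠ 0 ∧ (star Q = Q ∧ Q * Q = Q) ∧
      (star p = p ∧ p * p = p) ∧ Q * p * Q = (1 / 2 : ℂ) • Q := by
  refine ⟨CStarMatrix.ofMatrix !![1, 0; 0, 0],
    CStarMatrix.ofMatrix !![1 / 2, 1 / 2; 1 / 2, 1 / 2], ?_, ⟨?_, ?_⟩, ⟨?_, ?_⟩, ?_⟩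
  · intro h
    simpa using congrFun (congrFun h 0) 0
  all_goals
    ext i j
    fin_cases i <;> fin_cases j <;>
      simp [CStarMatrix.star_apply, CStarMatrix.mul_apply, Fin.sum_univ_two] <;> norm_num

section

variable {D : Type*} [Ring D] {n : ℕ}

/-- The matrix that mixes the indices `a` and `b` through the projections `p` and `1 - p` and has
`Q` at the other diagonal places. -/
def mixingMatrix (a b : Fin n) (Q p : D) (i j : Fin n) : D :=
  if i = j then (if i = a ∨ i = b then p else Q)
  else if i = a ∧ j = b ∨ i = b ∧ j = a then 1 - p else 0

variable {a b : Fin n} {Q p : D}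

/-- Reduces orthogonality within columns to orthogonality within rows. -/
theorem mixingMatrix_symm (i j : Fin n) :
    mixingMatrix a b Q p i j = mixingMatrix a b Q p j i := by
  unfold mixingMatrix
  grind

theorem star_mixingMatrix [StarRing D] (hQ : star Q = Q) (hp : star p = p) (i j : Fin n) :
    star (mixingMatrix a b Q p i j) = mixingMatrix a b Q p i j := by
  unfold mixingMatrix
  split_ifs <;> simp [hQ, hp]

theorem mixingMatrix_mul_self (hQ : Q * Q = Q) (hp : p * p = p) (i j : Fin n) :
    mixingMatrix a b Q p i j * mixingMatrix a b Q p i j = mixingMatrix a b Q p i j := by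
  unfold mixingMatrix
  split_ifs <;> simp [hQ, hp, mul_sub, sub_mul]

theorem mixingMatrix_mul_row (hp : p * p = p) (i k l : Fin n) (hkl : k ≠ l) :
    mixingMatrix a b Q p i k * mixingMatrix a b Q p i l = 0 := by
  have h1 : p * (1 - p) = 0 := by rw [mul_sub, hp, mul_one, sub_self]
  have h2 : (1 - p) * p = 0 := by rw [sub_mul, hp, one_mul, sub_self]
  unfold mixingMatrix
  grind

/-- The general `F` lets one computation serve both the column sums in `D` and the sums of tensors
`x j ⊗ₜ d`. -/
theorem sum_mixingMatrix_left {M : Type*} [AddCommMonoid M] (hab : a ≠ b) (F : Fin n → D → M)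
    (hF : ∀ j, F j 0 = 0) :
    ∑ j, F j (mixingMatrix a b Q p j a) = F a p + F b (1 - p) := by
  rw [← Finset.sum_subset (Finset.subset_univ {a, b}), Finset.sum_pair hab]
  · simp [mixingMatrix, hab.symm]
  · intro j _ hj
    rw [mixingMatrix, if_neg (by grind), if_neg (by grind), hF]

theorem sum_mixingMatrix_right {M : Type*} [AddCommMonoid M] (hab : a ≠ b) (F : Fin n → D → M)
    (hF : ∀ j, F j 0 = 0) :
    ∑ j, F j (mixingMatrix a b Q p j b) = F b p + F a (1 - p) := by
  rw [← Finset.sum_subset (Finset.subset_univ {b, a}), Finset.sum_pair hab.symm]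
  · simp [mixingMatrix, hab]
  · intro j _ hj
    rw [mixingMatrix, if_neg (by grind), if_neg (by grind), hF]

theorem sum_mixingMatrix_of_ne {M : Type*} [AddCommMonoid M] {c : Fin n} (hca : c ≠ a)
    (hcb : c ≠ b) (F : Fin n → D → M) (hF : ∀ j, F j 0 = 0) :
    ∑ j, F j (mixingMatrix a b Q p j c) = F c Q := by
  rw [Fintype.sum_eq_single c]
  · simp [mixingMatrix, hca, hcb]
  · intro j hj
    rw [mixingMatrix, if_neg hj, if_neg (by grind), hF]

/-- Columns `a` and `b` add up to `p + (1 - p) = 1`; every other column adds up to `Q`. -/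
theorem sum_mixingMatrix_mul (hab : a ≠ b) (hQ : Q * Q = Q) (i : Fin n) :
    ∑ k, mixingMatrix a b Q p k i * Q = Q := by
  rw [← Finset.sum_mul]
  by_cases ha : i = a
  · rw [ha, sum_mixingMatrix_left hab (fun _ d => d) fun _ => rfl]
    simp
  by_cases hb : i = b
  · rw [hb, sum_mixingMatrix_right hab (fun _ d => d) fun _ => rfl]
    simp
  rw [sum_mixingMatrix_of_ne ha hb (fun _ d => d) fun _ => rfl, hQ]

end

/-! ### Moment identities from the mixing model. -/

section Moments

variable {A : Type*} {n : ℕ} [Ring A] [Algebra ℂ A] {φ : A →ₗ[ℂ] ℂ} {x : Fin n → A}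

theorem tmul_add_tmul_pow {D : Type*} [Ring D] [Algebra ℂ D] {p : D} (hp : p * p = p) (s t : A)
    (k : ℕ) : (s ⊗ₜ[ℂ] p + t ⊗ₜ[ℂ] (1 - p)) ^ (k + 1) =
      (s ^ (k + 1)) ⊗ₜ[ℂ] p + (t ^ (k + 1)) ⊗ₜ[ℂ] (1 - p) := by
  induction k with
  | zero => simp
  | succ k ih =>
    rw [pow_succ, ih]
    simp [add_mul, mul_add, mul_sub, sub_mul, hp, ← pow_succ]

/-- On the word `a ⋯ a` the orthogonal idempotents `p` and `1 - p` never mix, and each compresses to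
`Q / 2`. Invariance thus makes the moment of `x a` the average of those of `x a` and `x b`. -/
theorem IsLinearCoactionInvariant.pow_eq
    (h : IsLinearCoactionInvariant n (jointDistribution φ x)) (a b : Fin n) (k : ℕ) :
    φ (x a ^ k) = φ (x b ^ k) := by
  rcases eq_or_ne a b with rfl | hab
  · rfl
  rcases k with _ | k
  · simp
  obtain ⟨Q, p, hQ0, hQ, hp, hQp⟩ := exists_projections_compress_eq_half
  have h1 := h.sliceCompress_prod (mixingMatrix a b Q p) Q
    (fun i j => ⟨star_mixingMatrix hQ.1 hp.1 i j, mixingMatrix_mul_self hQ.2 hp.2 i j⟩) hQ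
    (mixingMatrix_mul_row hp.2)
    (fun i k l hkl => by
      rw [mixingMatrix_symm k, mixingMatrix_symm l, mixingMatrix_mul_row hp.2 i k l hkl])
    (sum_mixingMatrix_mul hab hQ.2) (List.replicate (k + 1) a)
  have hQp' : Q * (1 - p) * Q = (1 / 2 : ℂ) • Q := by
    rw [mul_sub, sub_mul, hQp, mul_one, hQ.2]
    module
  simp only [List.map_replicate, List.prod_replicate] at h1
  rw [sum_mixingMatrix_left hab (fun j d => x j ⊗ₜ[ℂ] d) fun j => TensorProduct.tmul_zero _ _,
    tmul_add_tmul_pow hp.2, map_add, sliceCompress_tmul, sliceCompress_tmul, hQp, hQp', smul_smul,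
    smul_smul, ← add_smul] at h1
  have h2 := smul_left_injective ℂ hQ0 h1
  linear_combination (-2 : ℂ) * h2

/-- The word is `a c c a`. The letters `c` contribute `Q`, which separates the two outer entries, so
each compresses on its own to `Q / 2`. All four choices of outer indices from `a`, `b` therefore get
the same weight 1/4. -/
theorem IsLinearCoactionInvariant.sandwich_eq
    (h : IsLinearCoactionInvariant n (jointDistribution φ x)) {a b c : Fin n} (hab : a ≠ b)
    (hca : c ≠ a) (hcb : c ≠ b) :
    φ ((x a + x b) * (x c * x c) * (x a + x b)) = 4 * φ (x a * (x c * x c) * x a) := by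
  obtain ⟨Q, p, hQ0, hQ, hp, hQp⟩ := exists_projections_compress_eq_half
  have h1 := h.sliceCompress_prod (mixingMatrix a b Q p) Q
    (fun i j => ⟨star_mixingMatrix hQ.1 hp.1 i j, mixingMatrix_mul_self hQ.2 hp.2 i j⟩) hQ
    (mixingMatrix_mul_row hp.2)
    (fun i k l hkl => by
      rw [mixingMatrix_symm k, mixingMatrix_symm l, mixingMatrix_mul_row hp.2 i k l hkl])
    (sum_mixingMatrix_mul hab hQ.2) [a, c, c, a]
  have hQp' : Q * (1 - p) * Q = (1 / 2 : ℂ) • Q := by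
    rw [mul_sub, sub_mul, hQp, mul_one, hQ.2]
    module
  have key : ∀ d e : CStarMatrix (Fin 2) (Fin 2) ℂ, Q * d * Q = (1 / 2 : ℂ) • Q →
      Q * e * Q = (1 / 2 : ℂ) • Q → Q * (d * (Q * (Q * e))) * Q = (1 / 4 : ℂ) • Q := by
    intro d e hd he
    calc Q * (d * (Q * (Q * e))) * Q = (Q * d * Q) * (Q * e * Q) := by simp only [mul_assoc]
      _ = (1 / 4 : ℂ) • Q := by
        rw [hd, he, smul_mul_smul_comm, hQ.2]
        norm_num
  simp only [List.map_cons, List.map_nil, List.prod_cons, List.prod_nil, mul_one] at h1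
  rw [sum_mixingMatrix_left hab (fun j d => x j ⊗ₜ[ℂ] d) fun j => TensorProduct.tmul_zero _ _,
    sum_mixingMatrix_of_ne hca hcb (fun j d => x j ⊗ₜ[ℂ] d) fun j => TensorProduct.tmul_zero _ _]
    at h1
  simp only [add_mul, mul_add, Algebra.TensorProduct.tmul_mul_tmul, map_add, sliceCompress_tmul,
    key _ _ hQp hQp, key _ _ hQp hQp', key _ _ hQp' hQp, key _ _ hQp' hQp', smul_smul,
    ← add_smul] at h1
  have h2 := smul_left_injective ℂ hQ0 h1
  simp only [add_mul, mul_add, map_add, mul_assoc] at h2 ⊢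
  linear_combination (4 : ℂ) * h2

/-- The left side of `sandwich_eq` is symmetric in `a` and `b`, so the two diagonal terms agree and
the cross terms add up to twice their common value. -/
theorem IsLinearCoactionInvariant.map_sub_mul_sub_eq_zero
    (h : IsLinearCoactionInvariant n (jointDistribution φ x)) {a b c : Fin n} (hab : a ≠ b)
    (hca : c ≠ a) (hcb : c ≠ b) :
    φ ((x a - x b) * (x c * x c) * (x a - x b)) = 0 := by
  have h1 := h.sandwich_eq hab hca hcb
  have h2 := h.sandwich_eq hab.symm hcb hca
  simp only [add_mul, mul_add, sub_mul, mul_sub, map_add, map_sub, mul_assoc] at h1 h2 ⊢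
  linear_combination (-1 / 2 : ℂ) * h1 + (-1 / 2 : ℂ) * h2

end Moments

/-! ### Algebra of a sequence whose distinct members have a constant product. -/

section

variable {R : Type*} [Ring R] {x : ℕ → R} {T : R}

/-- `T` can be written as any product of two distinct members; one ending in `x i` lets the product
regroup into two copies of `T`. -/
theorem mul_mul_eq_mul_self (hT : ∀ i j, i ≠ j → x i * x j = T) {i j : ℕ} (hij : i ≠ j) :
    x i * T * x j = T * T := by
  obtain ⟨k, hk⟩ := exists_ne i
  calc x i * T * x j = x i * (x k * x i) * x j := by rw [hT k i hk]
    _ = (x i * x k) * (x i * x j) := by simp only [mul_assoc]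
    _ = T * T := by rw [hT i k hk.symm, hT i j hij]

/-- Writing `T` with two further indices `k`, `j` turns `x i * x k` into `T`, which leaves `x i * T
* x j`. -/
theorem sq_mul_eq_mul_self (hT : ∀ i j, i ≠ j → x i * x j = T) (i : ℕ) :
    x i * x i * T = T * T := by
  obtain ⟨j, hj⟩ := exists_ne i
  obtain ⟨k, hk⟩ := Infinite.exists_notMem_finset ({i, j} : Finset ℕ)
  simp only [Finset.mem_insert, Finset.mem_singleton, not_or] at hk
  calc x i * x i * T = x i * x i * (x k * x j) := by rw [hT k j hk.2]
    _ = x i * (x i * x k) * x j := by simp only [mul_assoc]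
    _ = T * T := by rw [hT i k (Ne.symm hk.1), mul_mul_eq_mul_self hT hj.symm]

theorem mul_sq_eq_mul_self (hT : ∀ i j, i ≠ j → x i * x j = T) (i : ℕ) :
    T * (x i * x i) = T * T := by
  obtain ⟨j, hj⟩ := exists_ne i
  obtain ⟨k, hk⟩ := Infinite.exists_notMem_finset ({i, j} : Finset ℕ)
  simp only [Finset.mem_insert, Finset.mem_singleton, not_or] at hk
  calc T * (x i * x i) = (x j * x k) * (x i * x i) := by rw [hT j k (Ne.symm hk.2)]
    _ = x j * (x k * x i) * x i := by simp only [mul_assoc]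
    _ = T * T := by rw [hT k i hk.1, mul_mul_eq_mul_self hT hj]

/-- If products of distinct members of a sequence do not depend on the indices, then the square
of each member is, up to that product, orthogonal to the square of any other. -/
theorem sq_sub_mul_sq_sub_eq_zero (hT : ∀ i j, i ≠ j → x i * x j = T) {i j : ℕ} (hij : i ≠ j) :
    (x i * x i - T) * (x j * x j - T) = 0 := by
  have h1 : x i * x i * (x j * x j) = T * T := by
    rw [← mul_mul_eq_mul_self hT hij]
    nth_rw 1 [← hT i j hij]
    simp only [mul_assoc]
  rw [sub_mul, mul_sub, mul_sub, h1, sq_mul_eq_mul_self hT, mul_sq_eq_mul_self hT]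
  simp

end

/-! ### Consequences of positivity and faithfulness, and the conclusion. -/

section Faithful

variable {A : Type*} [CStarAlgebra A] [PartialOrder A] {φ : A →ₚ[ℂ] ℂ}

theorem IsFaithfulFunctional.eq_zero_of_isSelfAdjoint (hφ : IsFaithfulFunctional φ) {a : A}
    (ha : IsSelfAdjoint a) (h : φ (a * a) = 0) : a = 0 :=
  hφ a (by rw [ha.star_eq, h])

/-- Pairwise orthogonal self-adjoint elements with the same first and second moments in a state
are centered: the means of `N` of them have variance of order `1 / N`. -/
theorem map_eq_zero_of_orthogonal [StarOrderedRing A] (hstate : IsState φ) {w : ℕ → A}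
    (hw : ∀ i, IsSelfAdjoint (w i)) (horth : ∀ i j, i ≠ j → w i * w j = 0) {m r : ℂ}
    (hm : ∀ i, φ (w i) = m) (hr : ∀ i, φ (w i * w i) = r) : m = 0 := by
  have hmstar : star m = m := by
    have h := map_star φ (w 0)
    rw [(hw 0).star_eq, hm] at h
    exact h.symm
  obtain ⟨t, rfl⟩ : ∃ t : ℝ, (t : ℂ) = m := Complex.conj_eq_iff_real.1 hmstar |>.imp fun _ => Eq.symm
  -- For `N > 0` this is positivity of the variance of the sum `S` of `N` terms: orthogonality
  -- removes the cross terms, so `0 ≤ φ ((S - N t) ^ 2) = N r - N² t²`, and one factor `N` cancels.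
  have hbound : ∀ N : ℕ, (N : ℝ) * t ^ 2 ≤ r.re := by
    intro N
    rcases N.eq_zero_or_pos with rfl | hN
    · have h0 : 0 ≤ φ (w 0 * w 0) := map_nonneg φ (hw 0).mul_self_nonneg
      rw [hr] at h0
      simpa using (Complex.le_def.1 h0).1
    set S := ∑ i ∈ Finset.range N, w i with hS
    have hSsa : IsSelfAdjoint S := by
      rw [IsSelfAdjoint, hS, star_sum]
      exact Finset.sum_congr rfl fun i _ => (hw i).star_eq
    have hSm : φ S = N * t := by simp [hS, map_sum, hm]
    have hSS : φ (S * S) = N * r := by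
      have h1 : S * S = ∑ i ∈ Finset.range N, w i * w i := by
        rw [hS, Finset.sum_mul_sum]
        refine Finset.sum_congr rfl fun i hi => ?_
        rw [Finset.sum_eq_single i (fun j _ hj => horth i j hj.symm) fun h => absurd hi h]
      simp [h1, map_sum, hr]
    set c : ℂ := ((N * t : ℝ) : ℂ) with hc
    have hcsa : IsSelfAdjoint (S - c • (1 : A)) := by
      refine hSsa.sub ?_
      rw [IsSelfAdjoint, star_smul, star_one, hc]
      simp
    have h0 : 0 ≤ φ ((S - c • (1 : A)) * (S - c • (1 : A))) := map_nonneg φ hcsa.mul_self_nonneg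
    have h1 : φ (1 : A) = 1 := hstate
    have h2 : φ ((S - c • (1 : A)) * (S - c • (1 : A))) = N * r - c ^ 2 := by
      simp only [sub_mul, mul_sub, map_sub, smul_mul_assoc, mul_smul_comm, mul_one, one_mul,
        map_smul, h1, hSS, hSm, smul_eq_mul]
      rw [hc]
      push_cast
      ring
    rw [h2] at h0
    have h3 := (Complex.le_def.1 h0).1
    rw [hc, ← Complex.ofReal_pow] at h3
    simp only [Complex.zero_re, Complex.sub_re, Complex.mul_re, Complex.natCast_re,
      Complex.natCast_im, zero_mul, sub_zero, Complex.ofReal_re] at h3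
    have hN' : (0 : ℝ) < N := by exact_mod_cast hN
    refine le_of_mul_le_mul_left ?_ hN'
    linarith [mul_pow (N : ℝ) t 2, sq (N : ℝ), mul_assoc (N : ℝ) N (t ^ 2)]
  by_contra ht
  have ht' : t ≠ 0 := by simpa using ht
  -- With `t ≠ 0` the left side of `hbound` grows without bound in `N`.
  obtain ⟨N, hN⟩ := exists_nat_gt (r.re / t ^ 2)
  rw [div_lt_iff₀ (by positivity)] at hN
  exact absurd (hbound N) (not_le.2 hN)

theorem SatisfiesLinearInvariance.map_pow_eq {x : ℕ → A}
    (h : SatisfiesLinearInvariance φ.toLinearMap x) (i j k : ℕ) : φ (x i ^ k) = φ (x j ^ k) :=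
  (h (i + j + 1)).pow_eq ⟨i, by omega⟩ ⟨j, by omega⟩ k

/-- With `y = x c * (x a - x b)`, the vanishing sandwich moment is `φ (star y * y)`, so faithfulness
gives `y = 0`. -/
theorem SatisfiesLinearInvariance.mul_left_eq {x : ℕ → A}
    (h : SatisfiesLinearInvariance φ.toLinearMap x) (hφ : IsFaithfulFunctional φ)
    (hx : ∀ i, IsSelfAdjoint (x i)) {a b c : ℕ} (hab : a ≠ b) (hca : c ≠ a) (hcb : c ≠ b) :
    x c * x a = x c * x b := by
  -- Any `n` exceeding all three indices would do.
  have h1 := (h (a + b + c + 1)).map_sub_mul_sub_eq_zero (a := ⟨a, by omega⟩) (b := ⟨b, by omega⟩)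
    (c := ⟨c, by omega⟩) (by simpa using hab) (by simpa using hca) (by simpa using hcb)
  rw [← sub_eq_zero, ← mul_sub]
  refine hφ _ ?_
  rw [star_mul, ((hx a).sub (hx b)).star_eq, (hx c).star_eq, mul_assoc, ← mul_assoc (x c),
    ← mul_assoc]
  exact h1

/-- The factors are exchanged one at a time through a fresh index `m`: the right factor by
`mul_left_eq`, the left factor by its adjoint. -/
theorem SatisfiesLinearInvariance.mul_eq {x : ℕ → A}
    (h : SatisfiesLinearInvariance φ.toLinearMap x) (hφ : IsFaithfulFunctional φ)
    (hx : ∀ i, IsSelfAdjoint (x i)) {i j : ℕ} (hij : i ≠ j) : x i * x j = x 0 * x 1 := by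
  obtain ⟨m, hm⟩ := Infinite.exists_notMem_finset ({0, 1, i, j} : Finset ℕ)
  simp only [Finset.mem_insert, Finset.mem_singleton, not_or] at hm
  obtain ⟨h0, h1, hi, hj⟩ := hm
  have e1 : x i * x j = x i * x m := h.mul_left_eq hφ hx (Ne.symm hj) hij (Ne.symm hi)
  have e2 : x i * x m = x 0 * x m := by
    rcases eq_or_ne i 0 with rfl | hi0
    · rfl
    have e := congrArg star (h.mul_left_eq hφ hx hi0 hi h0)
    simpa only [star_mul, (hx _).star_eq] using e
  have e3 : x 0 * x m = x 0 * x 1 := h.mul_left_eq hφ hx h1 (Ne.symm h0) zero_ne_one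
  rw [e1, e2, e3]

theorem SatisfiesLinearInvariance.eq [StarOrderedRing A] {x : ℕ → A}
    (h : SatisfiesLinearInvariance φ.toLinearMap x) (hstate : IsState φ)
    (hφ : IsFaithfulFunctional φ) (hx : ∀ i, IsSelfAdjoint (x i)) (i j : ℕ) : x i = x j := by
  have hT : ∀ i j, i ≠ j → x i * x j = x 0 * x 1 := fun i j hij => h.mul_eq hφ hx hij
  set T := x 0 * x 1 with hTdef
  have hTsa : IsSelfAdjoint T := by
    rw [IsSelfAdjoint, hTdef, star_mul, (hx 0).star_eq, (hx 1).star_eq, hT 1 0 one_ne_zero]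
  have hsq : ∀ i, φ (x i * x i) = φ (x 0 * x 0) := fun i => by
    simpa only [sq] using h.map_pow_eq i 0 2
  -- The second moment comes from `(x i ^ 2 - T) ^ 2 = x i ^ 4 - T ^ 2`, as `x i ^ 2 * T` and `T * x
  -- i ^ 2` both equal `T ^ 2`. Equality of moments of orders 2 and 4 makes `m` and `r` independent
  -- of `i`.
  have hzero := map_eq_zero_of_orthogonal hstate (w := fun i => x i * x i - T)
    (m := φ (x 0 * x 0) - φ T) (r := φ (x 0 ^ 4) - φ (T * T))
    (fun i => .sub (by rw [IsSelfAdjoint, star_mul, (hx i).star_eq]) hTsa)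
    (fun i j hij => sq_sub_mul_sq_sub_eq_zero hT hij) (fun i => by rw [map_sub, hsq])
    (fun i => by
      rw [← h.map_pow_eq i 0 4, sub_mul, mul_sub, mul_sub, sq_mul_eq_mul_self hT, mul_sq_eq_mul_self hT, sub_self,
        sub_zero, map_sub]
      congr 2
      noncomm_ring)
  rcases eq_or_ne i j with rfl | hij
  · rfl
  refine sub_eq_zero.1 (hφ.eq_zero_of_isSelfAdjoint ((hx i).sub (hx j)) ?_)
  rw [sub_mul, mul_sub, mul_sub, hT i j hij, hT j i hij.symm]
  simp only [map_sub, hsq i, hsq j]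
  -- Here `φ ((x i - x j) ^ 2)` has become `2 (φ (x 0 ^ 2) - φ T)`.
  linear_combination 2 * hzero

end Faithful

theorem mainTheorem4 {A : Type*} [CStarAlgebra A] [PartialOrder A] [StarOrderedRing A]
    [WStarAlgebra A] (φ : A →ₚ[ℂ] ℂ) (hstate : IsState φ) (hnormal : IsNormalFunctional φ)
    (hfaithful : IsFaithfulFunctional φ) (x : ℕ → A) (hx : ∀ i, IsSelfAdjoint (x i))
    (hgen : IsWStarGeneratedBy x) :
    SatisfiesLinearInvariance φ.toLinearMap x ↔ ∀ i j, x i = x j := by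
  refine ⟨fun h => h.eq hstate hfaithful hx, fun h n => ?_⟩
  rw [show (fun i : Fin n => x i) = fun _ => x 0 from funext fun i => h i 0]
  exact isLinearCoactionInvariant_const _ _
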